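/- For $p\in(0,1]$ let $$D_p=\Bigl\{z\in\mathbb C:\ \bigl|\sqrt{z+a_p}+\sqrt{z-a_p}\bigr|\le 2\sqrt p\ \text{ and }\ \bigl|\sqrt{z+a_p}-\sqrt{z-a_p}\bigr|\le 2\sqrt p\Bigr\},\qquad a_p=\sqrt{4p-4p^2},$$ where the complex square roots are principal (the set does not depend on the choice of branches). Let $p_1,p_2\in(0,1]$, let $H$ be a complex Hilbert space, and let $(x_{m,n})_{m,n\ge 0}$ be bounded operators on $H$ such that $x_{1,0}$ and $x_{0,1}$ are commuting normal operators with $\sigma(x_{1,0})\subseteq D_{p_1}$ and $\sigma(x_{0,1})\subseteq D_{p_2}$, such that $x_{0,0}=I$ and $x_{1,1}=x_{1,0}x_{0,1}$, and such that $$x_{1,0}\,x_{m,n}=p_1\,x_{m+1,n}+(1-p_1)\,x_{m-1,n}\qquad(m\ge 1,\ n\ge 0),$$ $$x_{0,1}\,x_{m,n}=p_2\,x_{m,n+1}+(1-p_2)\,x_{m,n-1}\qquad(m\ge 0,\ n\ge 1).$$ Let $P$ be the orthogonal projection of $H$ onto the closed subspace $\{\eta\in H: x_{1,0}\eta=x_{0,1}\eta=\eta\}$.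 Then the averages $$\frac1{k_1k_2}\sum_{m=0}^{k_1-1}\sum_{n=0}^{k_2-1}x_{m,n}$$ converge strongly to $P$ in Pringsheim's sense: for every $\xi\in H$ and every $\varepsilon>0$ there is $N\in\mathbb N$ such that $$\Bigl\|\frac1{k_1k_2}\sum_{m=0}^{k_1-1}\sum_{n=0}^{k_2-1}x_{m,n}\,\xi-P\xi\Bigr\|<\varepsilon\qquad\text{whenever }\min(k_1,k_2)\ge N.$$ -/

import Mathlib

/-- The region `D_p` of the complex plane. The complex square roots are the principal
ones; changing the branch of either of them can only interchange the two inequalities. -/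
def ergodicRegion (p : ℝ) : Set ℂ :=
  {z : ℂ |
    ‖Complex.sqrt (z + (Real.sqrt (4 * p - 4 * p ^ 2) : ℂ))
        + Complex.sqrt (z - (Real.sqrt (4 * p - 4 * p ^ 2) : ℂ))‖ ≤ 2 * Real.sqrt p ∧
    ‖Complex.sqrt (z + (Real.sqrt (4 * p - 4 * p ^ 2) : ℂ))
        - Complex.sqrt (z - (Real.sqrt (4 * p - 4 * p ^ 2) : ℂ))‖ ≤ 2 * Real.sqrt p}

/-- Convergence of a double sequence in Pringsheim's sense. -/
def PringsheimTendsto {E : Type*} [PseudoMetricSpace E] (ξ : ℕ → ℕ → E) (η : E) : Prop :=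
  ∀ ε : ℝ, 0 < ε → ∃ N : ℕ, ∀ k₁ k₂ : ℕ, N ≤ min k₁ k₂ → dist (ξ k₁ k₂) η < ε

/-- The average `(1 / (k₁ k₂)) ∑_{m < k₁} ∑_{n < k₂} x_{m,n}` of a double sequence of operators. -/
noncomputable def rectangleAverage {H : Type*} [NormedAddCommGroup H] [InnerProductSpace ℂ H]
    (x : ℕ → ℕ → H →L[ℂ] H) (k₁ k₂ : ℕ) : H →L[ℂ] H :=
  ((k₁ : ℂ) * (k₂ : ℂ))⁻¹ • ∑ m ∈ Finset.range k₁, ∑ n ∈ Finset.range k₂, x m n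

/-- The joint fixed space `{η | S η = η ∧ T η = η}` of two operators. -/
def jointFixedSpace {H : Type*} [NormedAddCommGroup H] [InnerProductSpace ℂ H]
    (S T : H →L[ℂ] H) : Submodule ℂ H where
  carrier := {η : H | S η = η ∧ T η = η}
  add_mem' := by
    rintro a b ⟨h1, h2⟩ ⟨h3, h4⟩
    exact ⟨by rw [map_add, h1, h3], by rw [map_add, h2, h4]⟩
  zero_mem' := ⟨map_zero S, map_zero T⟩
  smul_mem' := by
    rintro c a ⟨h1, h2⟩
    exact ⟨by rw [map_smul, h1], by rw [map_smul, h2]⟩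

theorem isClosed_jointFixedSpace {H : Type*} [NormedAddCommGroup H] [InnerProductSpace ℂ H]
    (S T : H →L[ℂ] H) : IsClosed (jointFixedSpace S T : Set H) :=
  (isClosed_eq S.continuous continuous_id).inter (isClosed_eq T.continuous continuous_id)

instance jointFixedSpace_hasOrthogonalProjection {H : Type*} [NormedAddCommGroup H]
    [InnerProductSpace ℂ H] [CompleteSpace H] (S T : H →L[ℂ] H) :
    (jointFixedSpace S T).HasOrthogonalProjection :=
  haveI : CompleteSpace (jointFixedSpace S T) :=
    (isClosed_jointFixedSpace S T).completeSpace_coe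
  inferInstance

open Filter Topology Polynomial

/-! Write `S = x 1 0`, `T = x 0 1`. The recurrences force `x m n` to be a polynomial in `S` times a
polynomial in `T`, so the rectangle average factors into two one-variable averages. On
`ergodicRegion p` the roots of `p t² - z t + (1 - p)` lie in the closed unit disc, which bounds the
polynomials uniformly; the functional calculus carries the bound to normal operators. Multiplied by
`T - 1`, their partial sums telescope to boundedly many bounded terms, so the averages tend to 0 on
the closure of the range of `T - 1`. They fix its kernel, and normality makes these two subspaces
orthogonal complements. Commutation then makes the product of the two limit projections the
projection onto the joint fixed space. -/

/-- The polynomials given by `φ₀ = 1`, `φ₁ = X` and `X φₘ = p φₘ₊₁ + (1 - p) φₘ₋₁`. -/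
noncomputable def sphericalPoly (p : ℂ) : ℕ → ℂ[X]
  | 0 => 1
  | 1 => X
  | n + 2 => C p⁻¹ * (X * sphericalPoly p (n + 1) - C (1 - p) * sphericalPoly p n)

theorem X_mul_sphericalPoly {p : ℂ} (hp : p ≠ 0) (n : ℕ) :
    X * sphericalPoly p (n + 1) =
      C p * sphericalPoly p (n + 2) + C (1 - p) * sphericalPoly p n := by
  rw [sphericalPoly, ← mul_assoc, ← C_mul, mul_inv_cancel₀ hp]
  simp

/-- The telescoping identity for the partial sums of the spherical polynomials. -/
theorem X_sub_one_mul_sum_sphericalPoly {p : ℂ} (hp : p ≠ 0) (k : ℕ) :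
    (X - 1) * ∑ m ∈ Finset.range (k + 1), sphericalPoly p m =
      C p * sphericalPoly p (k + 1) - C (1 - p) * sphericalPoly p k
        + C (1 - p) * sphericalPoly p 1 - C p * sphericalPoly p 0 := by
  induction k with
  | zero => simp [sphericalPoly]; ring
  | succ k ih =>
    have h := X_mul_sphericalPoly hp k
    rw [Finset.sum_range_succ, mul_add, ih, sub_mul, h]
    simp only [map_sub, map_one]
    ring

/-- Points of `ergodicRegion p` are those for which both roots of `p t² - z t + (1 - p)` lie in
the closed unit disc. -/
theorem exists_roots_of_mem_ergodicRegion {p : ℝ} (hp : 0 < p) (hp1 : p ≤ 1) {z : ℂ}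
    (hz : z ∈ ergodicRegion p) :
    ∃ a b : ℂ, ‖a‖ ≤ 1 ∧ ‖b‖ ≤ 1 ∧ p * (a + b) = z ∧ p * (a * b) = 1 - p := by
  obtain ⟨h1, h2⟩ := hz
  have hsq : ∀ w : ℂ, Complex.sqrt w ^ 2 = w := fun w => by
    rw [Complex.sqrt, ← Complex.cpow_nat_mul]; simp
  have hc : ((Real.sqrt (4 * p - 4 * p ^ 2) : ℝ) : ℂ) ^ 2 = 4 * p - 4 * p ^ 2 := by
    rw [← Complex.ofReal_pow, Real.sq_sqrt (by nlinarith)]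
    push_cast; ring
  set c : ℂ := ((Real.sqrt (4 * p - 4 * p ^ 2) : ℝ) : ℂ)
  have hu := hsq (z + c)
  have hv := hsq (z - c)
  set u := Complex.sqrt (z + c)
  set v := Complex.sqrt (z - c)
  have hp0 : (p : ℂ) ≠ 0 := by exact_mod_cast hp.ne'
  have key : ∀ w : ℂ, ‖w‖ ≤ 2 * Real.sqrt p → ‖w ^ 2 / (4 * p)‖ ≤ 1 := fun w hw => by
    have h4 : ‖(4 * p : ℂ)‖ = 4 * p := by
      rw [norm_mul, Complex.norm_real, Real.norm_of_nonneg hp.le]; norm_num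
    rw [norm_div, norm_pow, h4, div_le_one (by positivity)]
    calc ‖w‖ ^ 2 ≤ (2 * Real.sqrt p) ^ 2 := by gcongr
      _ = 4 * p := by rw [mul_pow, Real.sq_sqrt hp.le]; norm_num
  -- Since `u² = z + c` and `v² = z - c`, these have sum `z / p` and product `c² / (4p²) = (1 - p) /
  -- p`.
  refine ⟨(u + v) ^ 2 / (4 * p), (u - v) ^ 2 / (4 * p), key _ h1, key _ h2, ?_, ?_⟩
  · field_simp
    linear_combination 2 * hu + 2 * hv
  · have huv : (u + v) ^ 2 * (u - v) ^ 2 = 4 * c ^ 2 := by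
      have : (u + v) * (u - v) = 2 * c := by linear_combination hu - hv
      rw [← mul_pow, this]; ring
    field_simp
    rw [huv, hc]; ring

theorem eval_sphericalPoly_succ_succ {p a b : ℂ} (hp : p ≠ 0) (hab : p * (a * b) = 1 - p) (n : ℕ) :
    (sphericalPoly p (n + 2)).eval (p * (a + b)) =
      (a + b) * (sphericalPoly p (n + 1)).eval (p * (a + b))
        - a * b * (sphericalPoly p n).eval (p * (a + b)) := by
  simp only [sphericalPoly, eval_mul, eval_sub, eval_C, eval_X, ← hab]
  field_simp

theorem eval_sphericalPoly_of_mul_eq_one {p a b : ℂ} (hp : p = 1 / 2) (hab : a * b = 1) (n : ℕ) :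
    (sphericalPoly p n).eval (p * (a + b)) = (a ^ n + b ^ n) / 2 := by
  induction n using Nat.twoStepInduction with
  | zero => simp [sphericalPoly]
  | one => simp [sphericalPoly, hp]; ring
  | more n ih1 ih2 =>
    rw [eval_sphericalPoly_succ_succ (by simp [hp]) (by rw [hab, hp]; norm_num), ih1, ih2]
    ring

/-- With `f n` the value at `p (a + b)`, the difference `f (n + 1) - a * f n` is multiplied by `b`
at each step, hence decays geometrically; `‖a‖ ≤ 1` lets the differences be summed. Never dividing
by `a - b`, this covers double roots. -/
theorem norm_eval_sphericalPoly_le {p : ℝ} (hp : 0 < p) (hp1 : p ≤ 1) {a b : ℂ} (ha : ‖a‖ ≤ 1)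
    {s : ℝ} (hb : ‖b‖ ≤ s) (hs : s < 1) (hab : (p : ℂ) * (a * b) = 1 - p) (n : ℕ) :
    ‖(sphericalPoly p n).eval (p * (a + b))‖ ≤ 1 + 3 / (1 - s) := by
  have hp0 : (p : ℂ) ≠ 0 := by exact_mod_cast hp.ne'
  have hs0 : 0 ≤ s := (norm_nonneg b).trans hb
  set f : ℕ → ℂ := fun n => (sphericalPoly p n).eval (p * (a + b))
  have hrec : ∀ n, f (n + 2) = (a + b) * f (n + 1) - a * b * f n :=
    eval_sphericalPoly_succ_succ hp0 hab
  have hdiff : ∀ n, ‖f (n + 1) - a * f n‖ ≤ 3 * s ^ n := fun n => by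
    induction n with
    | zero =>
      have h : f 1 - a * f 0 = p * a + p * b - a := by simp [f, sphericalPoly]; ring
      have hpn : ‖(p : ℂ)‖ ≤ 1 := by rwa [Complex.norm_real, Real.norm_of_nonneg hp.le]
      have h1 : ‖(p : ℂ) * a‖ ≤ 1 := by
        rw [norm_mul]; exact mul_le_one₀ hpn (norm_nonneg _) ha
      have h2 : ‖(p : ℂ) * b‖ ≤ 1 := by
        rw [norm_mul]; exact mul_le_one₀ hpn (norm_nonneg _) (hb.trans hs.le)
      rw [h]
      linarith [norm_sub_le ((p : ℂ) * a + p * b) a, norm_add_le ((p : ℂ) * a) (p * b)]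
    | succ n ih =>
      have h : f (n + 1 + 1) - a * f (n + 1) = b * (f (n + 1) - a * f n) := by
        rw [hrec]; ring
      rw [h, norm_mul]
      calc _ ≤ s * (3 * s ^ n) := by gcongr
        _ = _ := by ring
  have hsum : ∀ n, ‖f n‖ ≤ 1 + 3 * ∑ i ∈ Finset.range n, s ^ i := fun n => by
    induction n with
    | zero => simp [f, sphericalPoly]
    | succ n ih =>
      have h1 : ‖a * f n‖ ≤ ‖f n‖ := by
        rw [norm_mul]; exact mul_le_of_le_one_left (norm_nonneg _) ha
      have h2 := norm_add_le (f (n + 1) - a * f n) (a * f n)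
      rw [sub_add_cancel] at h2
      rw [Finset.sum_range_succ]
      linarith [hdiff n]
  refine (hsum n).trans ?_
  have : ∑ i ∈ Finset.range n, s ^ i ≤ (1 - s)⁻¹ := by
    rw [← tsum_geometric_of_lt_one hs0 hs]
    exact (summable_geometric_of_lt_one hs0 hs).sum_le_tsum _ fun i _ => pow_nonneg hs0 i
  rw [div_eq_mul_inv]
  linarith

/-- The spherical polynomials are uniformly bounded on `ergodicRegion p`. -/
theorem exists_norm_eval_sphericalPoly_le {p : ℝ} (hp : 0 < p) (hp1 : p ≤ 1) :
    ∃ M : ℝ, 0 ≤ M ∧ ∀ z ∈ ergodicRegion p, ∀ n, ‖(sphericalPoly p n).eval z‖ ≤ M := by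
  have hr : ∀ {a b : ℂ}, (p : ℂ) * (a * b) = 1 - p → ‖a‖ * ‖b‖ = (1 - p) / p := fun {a b} h => by
    have h' := congrArg norm h
    rw [norm_mul, norm_mul, Complex.norm_real, Real.norm_of_nonneg hp.le, ← Complex.ofReal_one,
      ← Complex.ofReal_sub, Complex.norm_real, Real.norm_of_nonneg (by linarith)] at h'
    rw [eq_div_iff hp.ne', ← h', mul_comm]
  rcases lt_trichotomy p (1 / 2) with h | h | h
  -- Here the region is empty: the product of the roots would have modulus `(1 - p) / p > 1`.
  · refine ⟨0, le_rfl, fun z hz => ?_⟩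
    obtain ⟨a, b, ha, hb, -, hab⟩ := exists_roots_of_mem_ergodicRegion hp hp1 hz
    have h1 := hr hab
    have h2 := mul_le_one₀ ha (norm_nonneg b) hb
    rw [h1, div_le_one hp] at h2
    linarith
  · refine ⟨1, zero_le_one, fun z hz n => ?_⟩
    obtain ⟨a, b, ha, hb, rfl, hab⟩ := exists_roots_of_mem_ergodicRegion hp hp1 hz
    have hp' : (p : ℂ) = 1 / 2 := by rw [h]; norm_num
    have hab' : a * b = 1 := by rw [hp'] at hab; linear_combination 2 * hab
    rw [eval_sphericalPoly_of_mul_eq_one hp' hab', norm_div, RCLike.norm_ofNat]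
    have h1 := norm_add_le (a ^ n) (b ^ n)
    rw [norm_pow, norm_pow] at h1
    linarith [pow_le_one₀ (n := n) (norm_nonneg a) ha, pow_le_one₀ (n := n) (norm_nonneg b) hb]
  · have hs : Real.sqrt ((1 - p) / p) < 1 := by
      rw [Real.sqrt_lt' one_pos, div_lt_iff₀ hp]; linarith
    refine ⟨1 + 3 / (1 - Real.sqrt ((1 - p) / p)), ?_, fun z hz n => ?_⟩
    · have := sub_pos.2 hs
      positivity
    · obtain ⟨a, b, ha, hb, rfl, hab⟩ := exists_roots_of_mem_ergodicRegion hp hp1 hz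
      have h1 := hr hab
      -- The smaller modulus is at most the geometric mean `√((1 - p) / p)` of the two.
      rcases le_total ‖b‖ ‖a‖ with hle | hle
      · refine norm_eval_sphericalPoly_le hp hp1 ha (Real.le_sqrt_of_sq_le ?_) hs hab n
        rw [← h1, sq]
        gcongr
      · rw [add_comm a b]
        rw [mul_comm a b] at hab
        refine norm_eval_sphericalPoly_le hp hp1 hb (Real.le_sqrt_of_sq_le ?_) hs hab n
        rw [← h1, sq]
        gcongr

section Hilbert

variable {H : Type*} [NormedAddCommGroup H] [InnerProductSpace ℂ H]

theorem exists_norm_aeval_sphericalPoly_le [CompleteSpace H] {p : ℝ} (hp : 0 < p) (hp1 : p ≤ 1) {T : H →L[ℂ] H}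
    (hT : IsStarNormal T) (hspec : spectrum ℂ T ⊆ ergodicRegion p) :
    ∃ M : ℝ, 0 ≤ M ∧ ∀ n, ‖aeval T (sphericalPoly p n)‖ ≤ M := by
  obtain ⟨M, hM, h⟩ := exists_norm_eval_sphericalPoly_le hp hp1
  refine ⟨M, hM, fun n => ?_⟩
  rw [← cfc_polynomial (sphericalPoly p n) T hT]
  exact norm_cfc_le hM fun z hz => h z (hspec hz) n

/-- The average of the first `k` spherical polynomials of an operator. -/
noncomputable def sphericalAverage (p : ℂ) (T : H →L[ℂ] H) (k : ℕ) : H →L[ℂ] H :=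
  (k : ℂ)⁻¹ • ∑ m ∈ Finset.range k, aeval T (sphericalPoly p m)

theorem norm_sphericalAverage_le {p : ℂ} {T : H →L[ℂ] H} {M : ℝ} (hM : 0 ≤ M)
    (h : ∀ n, ‖aeval T (sphericalPoly p n)‖ ≤ M) (k : ℕ) : ‖sphericalAverage p T k‖ ≤ M := by
  rw [sphericalAverage, norm_smul, norm_inv, Complex.norm_natCast]
  rcases k.eq_zero_or_pos with rfl | hk
  · simpa using hM
  · rw [inv_mul_le_iff₀ (by exact_mod_cast hk)]
    simpa using norm_sum_le_of_le (Finset.range k) fun m _ => h m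

theorem aeval_sphericalPoly_apply_of_fixed {p : ℂ} (hp : p ≠ 0) {T : H →L[ℂ] H} {η : H}
    (hη : T η = η) (n : ℕ) : aeval T (sphericalPoly p n) η = η := by
  induction n using Nat.twoStepInduction with
  | zero => simp [sphericalPoly]
  | one => simpa [sphericalPoly] using hη
  | more n ih1 ih2 =>
    have h : aeval T (sphericalPoly p (n + 2)) η = p⁻¹ • (η - (1 - p) • η) := by
      rw [sphericalPoly, C_mul', C_mul', map_smul, map_sub, map_mul, map_smul, aeval_X,
        smul_apply, sub_apply,
        mul_apply_eq_comp, smul_apply, ih1, ih2, hη]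
    rw [h, sub_smul, one_smul, sub_sub_cancel, inv_smul_smul₀ hp]

theorem sphericalAverage_apply_of_fixed {p : ℂ} (hp : p ≠ 0) {T : H →L[ℂ] H} {η : H}
    (hη : T η = η) {k : ℕ} (hk : k ≠ 0) : sphericalAverage p T k η = η := by
  have hk' : (k : ℂ) ≠ 0 := by exact_mod_cast hk
  simp only [sphericalAverage, smul_apply, sum_apply,
    aeval_sphericalPoly_apply_of_fixed hp hη, Finset.sum_const, Finset.card_range]
  rw [← Nat.cast_smul_eq_nsmul ℂ, inv_smul_smul₀ hk']

theorem tendsto_sphericalAverage_sub_one_apply {p : ℂ} (hp : p ≠ 0) {T : H →L[ℂ] H} {M : ℝ}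
    (h : ∀ n, ‖aeval T (sphericalPoly p n)‖ ≤ M) (η : H) :
    Tendsto (fun k => sphericalAverage p T k ((T - 1) η)) atTop (𝓝 0) := by
  set K : ℝ := (‖p‖ * M + ‖1 - p‖ * M + ‖1 - p‖ * M + ‖p‖ * M) * ‖η‖
  refine squeeze_zero_norm' (a := fun k : ℕ => K / k) ?_ (tendsto_const_div_atTop_nhds_zero_nat K)
  filter_upwards [eventually_ne_atTop 0] with k hk
  obtain ⟨j, rfl⟩ := Nat.exists_eq_succ_of_ne_zero hk
  have heq : (∑ m ∈ Finset.range (j + 1), aeval T (sphericalPoly p m)) * (T - 1) =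
      p • aeval T (sphericalPoly p (j + 1)) - (1 - p) • aeval T (sphericalPoly p j)
        + (1 - p) • aeval T (sphericalPoly p 1) - p • aeval T (sphericalPoly p 0) := by
    have := congrArg (aeval T) (X_sub_one_mul_sum_sphericalPoly hp j)
    rw [mul_comm] at this
    simp only [C_mul'] at this
    simpa only [map_sub, map_add, map_mul, map_sum, map_smul, aeval_X, map_one] using this
  have hb : ∀ (c : ℂ) n, ‖c • aeval T (sphericalPoly p n)‖ ≤ ‖c‖ * M := fun c n => by
    rw [norm_smul]
    exact mul_le_mul_of_nonneg_left (h n) (norm_nonneg c)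
  rw [sphericalAverage, smul_apply, ← mul_apply_eq_comp, heq,
    norm_smul, norm_inv, Complex.norm_natCast, div_eq_inv_mul]
  refine mul_le_mul_of_nonneg_left (ContinuousLinearMap.le_of_opNorm_le _ ?_ η) (by positivity)
  exact norm_sub_le_of_le (norm_add_le_of_le (norm_sub_le_of_le (hb _ _) (hb _ _)) (hb _ _))
    (hb _ _)

theorem tendsto_zero_of_mem_closure {F : ℕ → H →L[ℂ] H} {M : ℝ} (hF : ∀ k, ‖F k‖ ≤ M)
    {s : Set H} (hs : ∀ η ∈ s, Tendsto (fun k => F k η) atTop (𝓝 0)) {ξ : H}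
    (hξ : ξ ∈ closure s) : Tendsto (fun k => F k ξ) atTop (𝓝 0) := by
  have hM : 0 ≤ M := (norm_nonneg _).trans (hF 0)
  rw [Metric.tendsto_atTop]
  intro ε hε
  obtain ⟨η, hη, hd⟩ := Metric.mem_closure_iff.1 hξ (ε / (2 * (M + 1))) (by positivity)
  obtain ⟨N, hN⟩ := Metric.tendsto_atTop.1 (hs η hη) (ε / 2) (by positivity)
  refine ⟨N, fun k hk => ?_⟩
  have h1 := hN k hk
  rw [dist_zero_right] at h1 ⊢
  rw [dist_eq_norm, lt_div_iff₀ (by positivity)] at hd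
  have h2 := (F k).le_of_opNorm_le (hF k) (ξ - η)
  have h3 := norm_add_le (F k (ξ - η)) (F k η)
  rw [← map_add, sub_add_cancel] at h3
  nlinarith [norm_nonneg (ξ - η)]

theorem isStarNormal_sub_one [CompleteSpace H] {T : H →L[ℂ] H} (hT : IsStarNormal T) : IsStarNormal (T - 1) := by
  refine ⟨?_⟩
  rw [star_sub, star_one]
  exact ((hT.star_comm_self.sub_left (Commute.one_left T)).sub_right (Commute.one_right _))

/-- The mean ergodic theorem for the spherical averages of one normal operator. -/
theorem tendsto_sphericalAverage_apply [CompleteSpace H] {p : ℝ} (hp : 0 < p) (hp1 : p ≤ 1) {T : H →L[ℂ] H}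
    (hT : IsStarNormal T) (hspec : spectrum ℂ T ⊆ ergodicRegion p) (ξ : H) :
    Tendsto (fun k => sphericalAverage p T k ξ) atTop (𝓝 ((T - 1).ker.starProjection ξ)) := by
  have hp0 : (p : ℂ) ≠ 0 := by exact_mod_cast hp.ne'
  obtain ⟨M, hM, h⟩ := exists_norm_aeval_sphericalPoly_le hp hp1 hT hspec
  set η := (T - 1).ker.starProjection ξ
  have hη : T η = η := by
    have : η ∈ (T - 1).ker := Submodule.starProjection_apply_mem _ ξ
    simpa [sub_eq_zero] using this
  have hcl : ξ - η ∈ closure ((T - 1).range : Set H) := by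
    have : ξ - η ∈ (T - 1).kerᗮ := Submodule.sub_starProjection_mem_orthogonal ξ
    -- Normality of `T - 1` enters here: its kernel is the orthogonal complement of its range.
    rwa [← ContinuousLinearMap.IsStarNormal.orthogonal_range (isStarNormal_sub_one hT),
      Submodule.orthogonal_orthogonal_eq_closure] at this
  have h0 := tendsto_zero_of_mem_closure (norm_sphericalAverage_le hM h) (fun ζ hζ => by
    obtain ⟨θ, rfl⟩ := hζ
    exact tendsto_sphericalAverage_sub_one_apply hp0 h θ) hcl
  refine (h0.add_const η).congr' ?_ |>.trans (by rw [zero_add])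
  filter_upwards [eventually_ne_atTop 0] with k hk
  rw [map_sub, sphericalAverage_apply_of_fixed hp0 hη hk, sub_add_cancel]

/-- The initial factor `R` allows the same induction to run along rows 0 and 1 and then along every
column. -/
theorem eq_aeval_sphericalPoly_mul {p : ℂ} (hp : p ≠ 0) {T R : H →L[ℂ] H} {y : ℕ → H →L[ℂ] H}
    (h0 : y 0 = R) (h1 : y 1 = T * R)
    (hrec : ∀ n, T * y (n + 1) = p • y (n + 2) + (1 - p) • y n) (n : ℕ) :
    y n = aeval T (sphericalPoly p n) * R := by
  induction n using Nat.twoStepInduction with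
  | zero => simp [sphericalPoly, h0]
  | one => simp [sphericalPoly, h1]
  | more n ih1 ih2 =>
    have h := hrec n
    rw [← sub_eq_iff_eq_add] at h
    rw [sphericalPoly, C_mul', C_mul', map_smul, map_sub, map_mul, map_smul, aeval_X, smul_mul_assoc,
      sub_mul, smul_mul_assoc, mul_assoc, ← ih1, ← ih2, h, inv_smul_smul₀ hp]

/-- The projections onto the fixed spaces of two commuting operators, the first of which is a
strong limit of operators commuting with the second operator, compose to the projection onto the
joint fixed space. -/
theorem starProjection_jointFixedSpace_apply [CompleteSpace H] {S T : H →L[ℂ] H} {F : ℕ → H →L[ℂ] H}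
    (hF : ∀ ξ, Tendsto (fun k => F k ξ) atTop (𝓝 ((S - 1).ker.starProjection ξ)))
    (hFT : ∀ k, Commute (F k) T) (ξ : H) :
    (jointFixedSpace S T).starProjection ξ =
      (S - 1).ker.starProjection ((T - 1).ker.starProjection ξ) := by
  have hmem : ∀ {R : H →L[ℂ] H} {η : H}, η ∈ (R - 1).ker ↔ R η = η := by
    simp [sub_eq_zero]
  set η := (T - 1).ker.starProjection ξ
  have hη : T η = η := hmem.1 (Submodule.starProjection_apply_mem _ ξ)
  refine Submodule.eq_starProjection_of_mem_of_inner_eq_zero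
    (show _ ∈ jointFixedSpace S T from ⟨?_, ?_⟩) fun μ hμ => ?_
  · exact hmem.1 (Submodule.starProjection_apply_mem _ η)
  -- `T (F k η) = F k (T η) = F k η`, so the limit is fixed by `T` too.
  · refine tendsto_nhds_unique ((T.continuous.tendsto _).comp (hF η)) ((hF η).congr fun k => ?_)
    have := congrArg (fun L : H →L[ℂ] H => L η) (hFT k).eq
    simpa [hη] using this
  · have h1 : (inner ℂ (ξ - η) μ : ℂ) = 0 :=
      Submodule.starProjection_inner_eq_zero ξ μ (hmem.2 hμ.2)
    have h2 : (inner ℂ (η - (S - 1).ker.starProjection η) μ : ℂ) = 0 :=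
      Submodule.starProjection_inner_eq_zero η μ (hmem.2 hμ.1)
    rw [← sub_add_sub_cancel ξ η, inner_add_left, h1, h2, add_zero]

/-- Split `F k₁ (G k₂ ξ) - ζ` as `F k₁ (G k₂ ξ - η) + (F k₁ η - ζ)`; the uniform bound on `F` makes
the first term small independently of `k₁`. -/
theorem pringsheimTendsto_comp_apply {F G : ℕ → H →L[ℂ] H} {M : ℝ} (hM : ∀ k, ‖F k‖ ≤ M)
    {ξ η ζ : H} (hG : Tendsto (fun k => G k ξ) atTop (𝓝 η))
    (hF : Tendsto (fun k => F k η) atTop (𝓝 ζ)) :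
    PringsheimTendsto (fun k₁ k₂ => (F k₁ * G k₂) ξ) ζ := by
  intro ε hε
  simp only [mul_apply_eq_comp]
  have hM0 : 0 ≤ M := (norm_nonneg _).trans (hM 0)
  obtain ⟨N₁, h₁⟩ := Metric.tendsto_atTop.1 hF (ε / 2) (by positivity)
  obtain ⟨N₂, h₂⟩ := Metric.tendsto_atTop.1 hG (ε / (2 * (M + 1))) (by positivity)
  refine ⟨max N₁ N₂, fun k₁ k₂ hk => ?_⟩
  obtain ⟨hk₁, hk₂⟩ := le_min_iff.1 hk
  have h3 := h₁ k₁ ((le_max_left _ _).trans hk₁)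
  have h4 := h₂ k₂ ((le_max_right _ _).trans hk₂)
  rw [dist_eq_norm, lt_div_iff₀ (by positivity)] at h4
  have h5 := (F k₁).le_of_opNorm_le (hM k₁) (G k₂ ξ - η)
  rw [map_sub, ← dist_eq_norm] at h5
  have h6 := dist_triangle (F k₁ (G k₂ ξ)) (F k₁ η) ζ
  nlinarith [norm_nonneg (G k₂ ξ - η)]

end Hilbert

theorem mainTheorem7 {H : Type*} [NormedAddCommGroup H] [InnerProductSpace ℂ H] [CompleteSpace H]
    (p₁ p₂ : ℝ) (hp₁ : 0 < p₁ ∧ p₁ ≤ 1) (hp₂ : 0 < p₂ ∧ p₂ ≤ 1)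
    (x : ℕ → ℕ → H →L[ℂ] H)
    (hcomm : Commute (x 1 0) (x 0 1))
    (hnormal₁ : IsStarNormal (x 1 0)) (hnormal₂ : IsStarNormal (x 0 1))
    (hspec₁ : spectrum ℂ (x 1 0) ⊆ ergodicRegion p₁)
    (hspec₂ : spectrum ℂ (x 0 1) ⊆ ergodicRegion p₂)
    (h00 : x 0 0 = 1)
    (h11 : x 1 1 = x 1 0 * x 0 1)
    (hrec₁ : ∀ m n : ℕ, 1 ≤ m →
      x 1 0 * x m n = (p₁ : ℂ) • x (m + 1) n + (1 - p₁ : ℂ) • x (m - 1) n)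
    (hrec₂ : ∀ m n : ℕ, 1 ≤ n →
      x 0 1 * x m n = (p₂ : ℂ) • x m (n + 1) + (1 - p₂ : ℂ) • x m (n - 1)) :
    ∀ ξ : H, PringsheimTendsto (fun k₁ k₂ : ℕ => rectangleAverage x k₁ k₂ ξ)
      ((jointFixedSpace (x 1 0) (x 0 1)).starProjection ξ) := by
  intro ξ
  have hp₁0 : (p₁ : ℂ) ≠ 0 := by exact_mod_cast hp₁.1.ne'
  have hp₂0 : (p₂ : ℂ) ≠ 0 := by exact_mod_cast hp₂.1.ne'
  have h0n : ∀ n, x 0 n = aeval (x 0 1) (sphericalPoly p₂ n) := fun n => by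
    simpa using eq_aeval_sphericalPoly_mul (y := fun n => x 0 n) (R := 1) hp₂0 h00 (mul_one _).symm
      (fun n => hrec₂ 0 (n + 1) n.succ_pos) n
  -- The recurrence in `m` starts from rows 0 and 1, so row 1 must be found first, from `h11` and
  -- the recurrence in `n`.
  have h1n : ∀ n, x 1 n = x 1 0 * x 0 n := fun n => by
    have hc : Commute (x 1 0) (x 0 n) := by
      rw [h0n, aeval_eq_sum_range]
      exact Commute.sum_right _ _ _ fun i _ => (hcomm.pow_right i).smul_right _
    rw [hc.eq, h0n]
    exact eq_aeval_sphericalPoly_mul (y := fun n => x 1 n) hp₂0 rfl (h11.trans hcomm.eq)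
      (fun n => hrec₂ 1 (n + 1) n.succ_pos) n
  have hmn : ∀ m n, x m n =
      aeval (x 1 0) (sphericalPoly p₁ m) * aeval (x 0 1) (sphericalPoly p₂ n) := fun m n => by
    rw [← h0n]
    exact eq_aeval_sphericalPoly_mul (y := fun m => x m n) hp₁0 rfl (h1n n)
      (fun m => hrec₁ (m + 1) n m.succ_pos) m
  have havg : ∀ k₁ k₂, rectangleAverage x k₁ k₂ =
      sphericalAverage p₁ (x 1 0) k₁ * sphericalAverage p₂ (x 0 1) k₂ := fun k₁ k₂ => by
    rw [rectangleAverage, Finset.sum_congr rfl fun m _ => Finset.sum_congr rfl fun n _ => hmn m n,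
      sphericalAverage, sphericalAverage, smul_mul_smul_comm, Finset.sum_mul_sum, mul_inv]
  obtain ⟨M, hM, hbd⟩ := exists_norm_aeval_sphericalPoly_le hp₁.1 hp₁.2 hnormal₁ hspec₁
  have hF := tendsto_sphericalAverage_apply hp₁.1 hp₁.2 hnormal₁ hspec₁
  have hFT : ∀ k, Commute (sphericalAverage (p₁ : ℂ) (x 1 0) k) (x 0 1) := fun k => by
    refine Commute.smul_left (Commute.sum_left _ _ _ fun m _ => ?_) _
    rw [aeval_eq_sum_range]
    exact Commute.sum_left _ _ _ fun i _ => (hcomm.pow_left i).smul_left _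
  simp only [havg]
  rw [starProjection_jointFixedSpace_apply hF hFT]
  exact pringsheimTendsto_comp_apply (norm_sphericalAverage_le hM hbd)
    (tendsto_sphericalAverage_apply hp₂.1 hp₂.2 hnormal₂ hspec₂ ξ) (hF _)
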